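/- **Setting.** Let $d\ge 1$, and let $L(\mathbb T^d)$ be the set of complex functions on $\mathbb R^d$ that are $2\pi$-periodic in each variable and summable on the cube of periods $[0,2\pi]^d$, functions that agree almost everywhere being identified. For $f\in L(\mathbb T^d)$ put $$\widehat f(\mathbf k)=(2\pi)^{-d}\int_{[0,2\pi]^d}f(\mathbf x)e^{-i(\mathbf k,\mathbf x)}\,d\mathbf x,\qquad \mathbf k\in\mathbb Z^d,$$ $$\|f\|_{\mathcal S^p}=\Big(\sum_{\mathbf k\in\mathbb Z^d}|\widehat f(\mathbf k)|^p\Big)^{1/p},$$ and let $\mathcal S^p$ be the set of $f\in L(\mathbb T^d)$ with $\|f\|_{\mathcal S^p}<\infty$. Let $Y=\mathbb Z^d_+\cup\mathbb Z^d_-$, where $\mathbb Z^d_+$ and $\mathbb Z^d_-$ are the sets of vectors in $\mathbb Z^d$ all of whose coordinates are nonnegative, respectively all of whose coordinates are negative, and let $L_{1,Y}$ be the set of $f\in L(\mathbb T^d)$ with $\widehat f(\mathbf k)=0$ for all $\mathbf k\in\mathbb Z^d\setminus Y$. For $n\in\mathbb N=\{1,2,\dots\}$ let $$E_n^\Delta(f)_{\mathcal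 S^p}=\inf\|f-g\|_{\mathcal S^p},$$ the infimum being over all trigonometric polynomials $g(\mathbf x)=\sum_{|\mathbf k|_1\le n-1}a_{\mathbf k}e^{i(\mathbf k,\mathbf x)}$, $a_{\mathbf k}\in\mathbb C$, where $|\mathbf k|_1=\sum_{j}|k_j|$. For $\alpha>0$ and $t\ge 0$ let $$\omega_\alpha^\Delta(f,t)_{\mathcal S^p}=\sup_{h\in\mathbb R,\ |h|\le t}\Big\|\sum_{j=0}^\infty(-1)^j\binom{\alpha}{j}f(\cdot-jh)\Big\|_{\mathcal S^p},$$ where $\mathbf x-jh=(x_1-jh,\dots,x_d-jh)$. For $\tau>0$ let $M(\tau)$ be the set of bounded nondecreasing functions $\mu$ that are not constant on $[0,\tau]$, and for $1\le p<\infty$ put $$C_{n,\alpha,p}(\tau)=\left(\inf_{\mu\in M(\tau)}\frac{\mu(\tau)-\mu(0)}{2^{\alpha p/2}I_n(\tau,\mu)}\right)^{1/p},$$ $$I_n(\tau,\mu)=\inf_{\nu\in\mathbb N,\ \nu\ge n}\int_0^\tau\Big(1-\cos\frac{\nu t}{n}\Big)^{\alpha p/2}d\mu(t),$$ where the integral is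 a Stieltjes integral over $[0,\tau]$ and the quotient is $+\infty$ if $I_n(\tau,\mu)=0$; and $$K_{n,\alpha,p}(\tau)=\sup\left\{\frac{E_n^\Delta(f)_{\mathcal S^p}}{\omega_\alpha^\Delta(f,\tau/n)_{\mathcal S^p}}:\ f\in\mathcal S^p\cap L_{1,Y},\ f\ne\mathrm{const}\right\}.$$ **Theorem 3.1.** Let $1\le p<\infty$, $\tau>0$, $n\in\mathbb N$ and $\alpha>0$. Then $C_{n,\alpha,p}(\tau)<\infty$, and for every $f\in\mathcal S^p\cap L_{1,Y}$ $$E_n^\Delta(f)_{\mathcal S^p}\le C_{n,\alpha,p}(\tau)\,\omega_\alpha^\Delta\Big(f,\frac{\tau}{n}\Big)_{\mathcal S^p}.$$ Moreover, there is a function $\mu_*\in M(\tau)$ that attains the infimum in the definition of $C_{n,\alpha,p}(\tau)$, and the inequality is sharp in the sense that $$C_{n,\alpha,p}(\tau)=K_{n,\alpha,p}(\tau).$$ -/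

import Mathlib

open MeasureTheory Set
open scoped ENNReal

noncomputable section

namespace JacksonSp

instance fact_two_pi_pos : Fact (0 < 2 * Real.pi) := ⟨Real.two_pi_pos⟩

/-- The torus `ℝ^d / (2πℤ)^d`. Functions on it are the functions on `ℝ^d` that are `2π`-periodic in
each variable; its `volume` is Lebesgue measure on the cube of periods (total mass `(2π)^d`). -/
abbrev Torus (d : ℕ) : Type := Fin d → AddCircle (2 * Real.pi)

/-- The character `x ↦ e^{i(k,x)}`. -/
def expo {d : ℕ} (k : Fin d → ℤ) (x : Torus d) : ℂ := ∏ j, fourier (k j) (x j)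

theorem expo_coe {d : ℕ} (k : Fin d → ℤ) (y : Fin d → ℝ) :
    expo k (fun j => (y j : AddCircle (2 * Real.pi))) =
      Complex.exp (Complex.I * ∑ j, (k j : ℂ) * (y j : ℂ)) := by
  have hpi : (Real.pi : ℂ) ≠ 0 := by exact_mod_cast Real.pi_ne_zero
  unfold expo
  rw [Finset.mul_sum, Complex.exp_sum]
  refine Finset.prod_congr rfl fun j _ => ?_
  rw [fourier_coe_apply]
  congr 1
  push_cast
  field_simp

/-- The Fourier coefficient `(2π)^{-d} ∫ f(x) e^{-i(k,x)} dx`. -/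
def coeff {d : ℕ} (f : Torus d → ℂ) (k : Fin d → ℤ) : ℂ :=
  (((2 * Real.pi) ^ d)⁻¹ : ℝ) * ∫ x, f x * (starRingEnd ℂ) (expo k x)

/-- The norm `(∑_k |f̂(k)|^p)^{1/p}`, with value `∞` allowed. -/
def spNorm {d : ℕ} (p : ℝ) (f : Torus d → ℂ) : ℝ≥0∞ :=
  (∑' k : Fin d → ℤ, ENNReal.ofReal (‖coeff f k‖ ^ p)) ^ (1 / p)

/-- Membership in the space `S^p`: summable functions with finite norm. -/
def MemSp {d : ℕ} (p : ℝ) (f : Torus d → ℂ) : Prop :=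
  Integrable f ∧ spNorm p f < ∞

/-- `Y = ℤ_+^d ∪ ℤ_-^d`: all coordinates nonnegative, or all coordinates negative. -/
def specY (d : ℕ) : Set (Fin d → ℤ) := {k | ∀ j, 0 ≤ k j} ∪ {k | ∀ j, k j < 0}

/-- The Fourier coefficients of `f` vanish outside `Y`. -/
def HasSpecY {d : ℕ} (f : Torus d → ℂ) : Prop := ∀ k, k ∉ specY d → coeff f k = 0

/-- `|k|_1 = ∑_j |k_j|`. -/
def l1 {d : ℕ} (k : Fin d → ℤ) : ℕ := ∑ j, (k j).natAbs

/-- Triangular polynomials `∑_{|k|_1 ≤ m} a_k e^{i(k,x)}`. -/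
def triPoly (d m : ℕ) : Submodule ℂ (Torus d → ℂ) :=
  Submodule.span ℂ (expo '' {k : Fin d → ℤ | l1 k ≤ m})

/-- The best approximation of `f` of order `n - 1` by triangular polynomials (for `n ≥ 1`). -/
def bestApprox {d : ℕ} (p : ℝ) (n : ℕ) (f : Torus d → ℂ) : ℝ≥0∞ :=
  ⨅ g ∈ triPoly d (n - 1), spNorm p (f - g)

/-- The difference `∑_{j ≥ 0} (-1)^j (α choose j) f(x - jh)` of order `α`, where `x - jh` means that
the scalar `jh` is subtracted from every coordinate of `x`. For summable `f` and `α > 0` the series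
converges absolutely at almost every `x`. -/
def fracDiff {d : ℕ} (α h : ℝ) (f : Torus d → ℂ) (x : Torus d) : ℂ :=
  ∑' j : ℕ, (((-1) ^ j * Ring.choose α j : ℝ) : ℂ) *
    f (fun i => x i - ((j * h : ℝ) : AddCircle (2 * Real.pi)))

/-- The modulus of smoothness of order `α`. -/
def modulus {d : ℕ} (p α : ℝ) (f : Torus d → ℂ) (t : ℝ) : ℝ≥0∞ :=
  ⨆ h ∈ {h : ℝ | |h| ≤ t}, spNorm p (fracDiff α h f)

/-- The set of functions that are nondecreasing (hence bounded) and nonconstant on `[0, τ]`.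
Only the values on `[0, τ]` are ever used. -/
def admissible (τ : ℝ) : Set (ℝ → ℝ) :=
  {μ | MonotoneOn μ (Icc 0 τ) ∧ ¬ ∃ c, ∀ t ∈ Icc 0 τ, μ t = c}

/-- The extension of `μ` from `[0, τ]` by the constants `μ 0` and `μ τ`. -/
def clampExt (τ : ℝ) (μ : ℝ → ℝ) (t : ℝ) : ℝ := μ (max 0 (min τ t))

open Classical in
/-- The Lebesgue-Stieltjes measure `dμ` of `μ` on `[0, τ]`, including the jumps of `μ` at both end
points, so that its total mass is `μ τ - μ 0` (it is `0` if `μ` is not nondecreasing). -/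
def stieltjesMeasure (τ : ℝ) (μ : ℝ → ℝ) : Measure ℝ :=
  if h : Monotone (clampExt τ μ) then h.stieltjesFunction.measure else 0

/-- `I_n(τ, μ) = inf_{ν ≥ n} ∫_0^τ (1 - cos (νt/n))^{αp/2} dμ(t)`. -/
def infIntegral (n : ℕ) (α p τ : ℝ) (μ : ℝ → ℝ) : ℝ :=
  ⨅ ν : {ν : ℕ // n ≤ ν},
    ∫ t in Icc 0 τ, (1 - Real.cos ((ν : ℕ) / n * t)) ^ (α * p / 2) ∂(stieltjesMeasure τ μ)

/-- `(μ(τ) - μ(0)) / (2^{αp/2} I_n(τ, μ))`, which is `∞` if the denominator vanishes. -/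
def ratio (n : ℕ) (α p τ : ℝ) (μ : ℝ → ℝ) : ℝ≥0∞ :=
  ENNReal.ofReal (μ τ - μ 0) /
    ENNReal.ofReal ((2 : ℝ) ^ (α * p / 2) * infIntegral n α p τ μ)

/-- The constant `C_{n,α,p}(τ)`. -/
def constC (n : ℕ) (α p τ : ℝ) : ℝ≥0∞ :=
  (⨅ μ ∈ admissible τ, ratio n α p τ μ) ^ (1 / p)

/-- The exact Jackson constant `K_{n,α,p}(τ)`: the supremum of `E_n(f) / ω_α(f, τ/n)` over the
nonconstant functions of `S^p` with spectrum in `Y`. -/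
def constK (d n : ℕ) (α p τ : ℝ) : ℝ≥0∞ :=
  ⨆ f ∈ {f : Torus d → ℂ | MemSp p f ∧ HasSpecY f ∧ ¬ ∃ c : ℂ, f =ᵐ[volume] fun _ => c},
    bestApprox p n f / modulus p α f (τ / n)

end JacksonSp

end

noncomputable section

namespace JacksonSp

/-! ### The binomial series on the closed unit disc -/

/-! In Fourier coefficients the difference of step `h` multiplies the `k`-th coefficient by a number
of modulus `(2(1 - cos(h ∑ k_i)))^(α/2)`. On `Y` one has `|∑ k_i| = |k|_1`, so with `ν = |k|_1` and
`φ_ν(t) = (2(1 - cos(νt/n)))^(αp/2)` the `p`-th power of the difference norm at `h = t/n` is `∑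
φ_ν(t) |f̂(k)|^p`, while `E_n^p` is the sum of `|f̂(k)|^p` over `|k|_1 ≥ n` (`spNorm_fracDiff_rpow`,
`bestApprox_rpow`). Integrating over `dμ(t)` gives the inequality with the constant of any `μ` whose
ratio is finite (`mul_bestApprox_rpow_le`).

Sharpness is the minimax theorem for the game in which one player picks `ν ≥ n`, the other `t ∈ [0,
τ]`, and the payoff is `φ_ν(t)`. Let `c` be its value. The `t`-player has an optimal probability
measure, by Hahn-Banach and Riesz (`exists_probabilityMeasure_le_integral`); its distribution
function is the extremal `μ_*`, with ratio `1/c`. For each `b > c` the `ν`-player has finitely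
supported weights holding the payoff below `b`. These weights show that no `μ` has ratio below `1/c`
(`inv_le_ratio`), and, read as `|f̂|^p`, they give a polynomial with `E_n = 1` and `ω^p ≤ b`
(`inv_rpow_le_constK`). Finiteness of the constant is `c > 0`, which follows by letting `t` be
uniform on `[0, τ]` (`exists_le_integral_one_sub_cos_rpow`). -/

theorem succ_mul_choose_succ (α : ℝ) (j : ℕ) :
    ((j : ℝ) + 1) * Ring.choose α (j + 1) = Ring.choose α j * (α - j) := by
  have h := Ring.choose_smul_choose α (Nat.le_succ j)
  simpa [Nat.succ_sub (le_refl j)] using h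

/-- For `j > α` the recursion gives `(j + 1)|C_(j+1)| = (j - α)|C_j|`, where `C_j` is the binomial
coefficient. Hence `α|C_j|` is the telescoping difference `j|C_j| - (j + 1)|C_(j+1)|`. -/
theorem summable_abs_choose {α : ℝ} (hα : 0 < α) :
    Summable fun j : ℕ => |Ring.choose α j| := by
  obtain ⟨N, hN⟩ := exists_nat_gt α
  rw [← summable_nat_add_iff N]
  have step : ∀ j : ℕ, α * |Ring.choose α (j + N)| =
      ((j + N : ℕ) : ℝ) * |Ring.choose α (j + N)| -
        ((j + 1 + N : ℕ) : ℝ) * |Ring.choose α (j + 1 + N)| := by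
    intro j
    have h := congrArg abs (succ_mul_choose_succ α (j + N))
    have hj : α - ((j + N : ℕ) : ℝ) < 0 := by push_cast; linarith [(Nat.cast_nonneg j : (0 : ℝ) ≤ j)]
    rw [abs_mul, abs_mul, abs_of_neg hj, abs_of_nonneg (by positivity)] at h
    rw [show j + 1 + N = j + N + 1 by ring]
    push_cast at h ⊢
    linarith
  have : Summable fun j : ℕ => α * |Ring.choose α (j + N)| := by
    refine summable_of_sum_range_le (c := ((0 + N : ℕ) : ℝ) * |Ring.choose α (0 + N)|)
      (fun j => by positivity) fun n => ?_
    simp_rw [step]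
    rw [Finset.sum_range_sub' (fun j : ℕ => ((j + N : ℕ) : ℝ) * |Ring.choose α (j + N)|)]
    have : 0 ≤ ((n + N : ℕ) : ℝ) * |Ring.choose α (n + N)| := by positivity
    linarith
  exact (summable_mul_left_iff hα.ne').1 this

theorem norm_binomial_tsum_of_norm_lt_one (α : ℝ) {z : ℂ} (hz : ‖z‖ < 1) :
    ‖∑' j : ℕ, (((-1) ^ j * Ring.choose α j : ℝ) : ℂ) * z ^ j‖ = ‖1 - z‖ ^ α := by
  have h := (Complex.one_add_cpow_hasFPowerSeriesOnBall_zero (a := (α : ℂ))).hasSum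
    (y := -z) (by simpa [enorm_eq_nnnorm, ← NNReal.coe_lt_coe] using hz)
  simp only [zero_add] at h
  rw [show 1 - z = 1 + -z by ring, ← Complex.norm_cpow_real, ← h.tsum_eq]
  congr 1
  refine tsum_congr fun j => ?_
  rw [binomialSeries_apply]
  simp only [List.ofFn_const, List.prod_replicate, ← Complex.ofReal_choose]
  rw [smul_eq_mul, neg_pow z]
  push_cast
  ring

/-- The values needed are at `|z| = 1`. Both sides are continuous on the closed disc, the left one
because the series converges uniformly, and they agree inside. -/
theorem norm_binomial_tsum {α : ℝ} (hα : 0 < α) {z : ℂ} (hz : ‖z‖ ≤ 1) :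
    ‖∑' j : ℕ, (((-1) ^ j * Ring.choose α j : ℝ) : ℂ) * z ^ j‖ = ‖1 - z‖ ^ α := by
  have hcont : ContinuousOn
      (fun z : ℂ => ∑' j : ℕ, (((-1) ^ j * Ring.choose α j : ℝ) : ℂ) * z ^ j)
      (Metric.closedBall 0 1) := by
    refine continuousOn_tsum (fun j => by fun_prop) (summable_abs_choose hα) fun j w hw => ?_
    have hw' : ‖w‖ ≤ 1 := by simpa using hw
    rw [norm_mul, Complex.norm_real, norm_pow, Real.norm_eq_abs, abs_mul, abs_pow, abs_neg, abs_one,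
      one_pow, one_mul]
    exact mul_le_of_le_one_right (abs_nonneg _) (pow_le_one₀ (norm_nonneg _) hw')
  have hr : ContinuousOn (fun w : ℂ => ‖1 - w‖ ^ α) (Metric.closedBall 0 1) :=
    (Continuous.rpow_const (by fun_prop) fun _ => Or.inr hα.le).continuousOn
  have heq : EqOn
      (fun z : ℂ => ‖∑' j : ℕ, (((-1) ^ j * Ring.choose α j : ℝ) : ℂ) * z ^ j‖)
      (fun w : ℂ => ‖1 - w‖ ^ α) (Metric.ball 0 1) := fun w hw =>
    norm_binomial_tsum_of_norm_lt_one α (by simpa using hw)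
  have := heq.of_subset_closure hcont.norm hr Metric.ball_subset_closedBall
    (by rw [closure_ball _ one_ne_zero])
  exact this (by simpa using hz)

theorem norm_one_sub_exp_rpow (x β : ℝ) :
    ‖1 - Complex.exp (x * Complex.I)‖ ^ β = (2 * (1 - Real.cos x)) ^ (β / 2) := by
  have h : ‖1 - Complex.exp (x * Complex.I)‖ ^ 2 = 2 * (1 - Real.cos x) := by
    rw [← Complex.normSq_eq_norm_sq, Complex.normSq_apply]
    simp [Complex.exp_ofReal_mul_I_re, Complex.exp_ofReal_mul_I_im]
    nlinarith [Real.sin_sq_add_cos_sq x]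
  rw [← h, ← Real.rpow_natCast, ← Real.rpow_mul (norm_nonneg _)]
  congr 1
  push_cast
  ring

/-! ### Fourier coefficients on the torus -/

variable {d : ℕ}

theorem continuous_expo (k : Fin d → ℤ) : Continuous (expo k : Torus d → ℂ) := by
  unfold expo
  fun_prop

theorem norm_expo (k : Fin d → ℤ) (x : Torus d) : ‖expo k x‖ = 1 := by
  unfold expo
  rw [norm_prod]
  exact Finset.prod_eq_one fun j _ => by rw [fourier_apply]; exact Circle.norm_coe _

theorem expo_add (k : Fin d → ℤ) (x y : Torus d) : expo k (x + y) = expo k x * expo k y := by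
  simp only [expo, Pi.add_apply, ← Finset.prod_mul_distrib]
  refine Finset.prod_congr rfl fun j _ => ?_
  simp [fourier_apply, AddCircle.toCircle_add]

theorem integrable_expo (k : Fin d → ℤ) : Integrable (expo k : Torus d → ℂ) :=
  Integrable.of_bound (continuous_expo k).aestronglyMeasurable 1
    (.of_forall fun x => (norm_expo k x).le)

theorem integrable_mul_conj_expo {f : Torus d → ℂ} (hf : Integrable f) (k : Fin d → ℤ) :
    Integrable fun x => f x * (starRingEnd ℂ) (expo k x) := by
  refine hf.mul_bdd (c := 1)
    (Complex.continuous_conj.comp (continuous_expo k)).aestronglyMeasurable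
    (.of_forall fun x => ?_)
  simp [norm_expo]

theorem coeff_expo (m k : Fin d → ℤ) : coeff (expo m) k = if k = m then 1 else 0 := by
  have h1 : ∀ a b : ℤ, ∫ x : AddCircle (2 * Real.pi), fourier a x * (starRingEnd ℂ) (fourier b x)
      = if b = a then ((2 * Real.pi : ℝ) : ℂ) else 0 := by
    intro a b
    have h := congrFun (fourierCoeff_fourier (T := 2 * Real.pi) a) b
    rw [fourierCoeff, AddCircle.integral_haarAddCircle, Pi.single_apply] at h
    have h2 : ∫ x : AddCircle (2 * Real.pi), fourier a x * (starRingEnd ℂ) (fourier b x) =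
        ∫ x : AddCircle (2 * Real.pi), fourier (-b) x • fourier a x := by
      refine integral_congr_ae (.of_forall fun x => ?_)
      simp only [fourier_neg, smul_eq_mul]
      ring
    rw [h2, ← smul_inv_smul₀ Real.two_pi_pos.ne'
      (∫ x : AddCircle (2 * Real.pi), fourier (-b) x • fourier a x), h]
    split_ifs <;> simp
  unfold coeff expo
  simp_rw [map_prod, ← Finset.prod_mul_distrib]
  rw [integral_fintype_prod_volume_eq_prod
    (fun (j : Fin d) (x : AddCircle (2 * Real.pi)) =>
      fourier (m j) x * (starRingEnd ℂ) (fourier (k j) x))]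
  simp_rw [h1]
  split_ifs with hkm
  · subst hkm
    have : (Real.pi : ℂ) ≠ 0 := by exact_mod_cast Real.pi_ne_zero
    simp only [if_true, Finset.prod_const, Finset.card_univ, Fintype.card_fin]
    push_cast
    field_simp
  · obtain ⟨j, hj⟩ := Function.ne_iff.1 hkm
    rw [Finset.prod_eq_zero (Finset.mem_univ j) (if_neg hj), mul_zero]

theorem coeff_add {f g : Torus d → ℂ} (hf : Integrable f) (hg : Integrable g) (k : Fin d → ℤ) :
    coeff (f + g) k = coeff f k + coeff g k := by
  simp only [coeff, Pi.add_apply, add_mul]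
  rw [integral_add (integrable_mul_conj_expo hf k) (integrable_mul_conj_expo hg k), mul_add]

theorem coeff_smul (c : ℂ) (f : Torus d → ℂ) (k : Fin d → ℤ) :
    coeff (c • f) k = c * coeff f k := by
  simp only [coeff, Pi.smul_apply, smul_eq_mul, mul_assoc]
  rw [integral_const_mul]
  ring

theorem coeff_sub {f g : Torus d → ℂ} (hf : Integrable f) (hg : Integrable g) (k : Fin d → ℤ) :
    coeff (f - g) k = coeff f k - coeff g k := by
  simp only [coeff, Pi.sub_apply, sub_mul]
  rw [integral_sub (integrable_mul_conj_expo hf k) (integrable_mul_conj_expo hg k), mul_sub]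

theorem coeff_sum_expo (s : Finset (Fin d → ℤ)) (a : (Fin d → ℤ) → ℂ) :
    Integrable (∑ m ∈ s, a m • expo m : Torus d → ℂ) ∧
      ∀ k, coeff (∑ m ∈ s, a m • expo m) k = if k ∈ s then a k else 0 := by
  classical
  induction s using Finset.induction_on with
  | empty => exact ⟨by simp, fun k => by simp [coeff]⟩
  | insert m s hm ih =>
    rw [Finset.sum_insert hm]
    have hi := (integrable_expo m).smul (a m)
    refine ⟨hi.add ih.1, fun k => ?_⟩
    rw [coeff_add hi ih.1, ih.2, coeff_smul, coeff_expo]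
    by_cases h : k = m
    · subst h; simp [hm]
    · simp [h]

theorem coeff_translate (f : Torus d → ℂ) (c : Torus d) (k : Fin d → ℤ) :
    coeff (fun x => f (x - c)) k = (starRingEnd ℂ) (expo k c) * coeff f k := by
  have h := integral_sub_right_eq_self (μ := (volume : Measure (Torus d)))
    (fun x => f x * (starRingEnd ℂ) (expo k (x + c))) c
  simp only [sub_add_cancel] at h
  simp only [coeff, h, expo_add, map_mul]
  rw [show (fun x => f x * ((starRingEnd ℂ) (expo k x) * (starRingEnd ℂ) (expo k c))) =
    fun x => (starRingEnd ℂ) (expo k c) * (f x * (starRingEnd ℂ) (expo k x)) by ext; ring,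
    integral_const_mul]
  ring

/-- The shift is the same in all coordinates, so only `∑ k_i` enters; this makes the problem
one-dimensional. -/
theorem conj_expo_diag (k : Fin d → ℤ) (h : ℝ) (j : ℕ) :
    (starRingEnd ℂ) (expo k fun _ => ((j * h : ℝ) : AddCircle (2 * Real.pi))) =
      Complex.exp ((-(h * ((∑ i, k i : ℤ) : ℝ)) : ℝ) * Complex.I) ^ j := by
  rw [expo_coe k (fun _ => (j * h : ℝ)), ← Complex.exp_conj, ← Complex.exp_nat_mul, ← Finset.sum_mul]
  congr 1
  simp
  ring

theorem coeff_fracDiff {α : ℝ} (hα : 0 < α) (h : ℝ) {f : Torus d → ℂ} (hf : Integrable f)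
    (k : Fin d → ℤ) :
    coeff (fracDiff α h f) k =
      (∑' j : ℕ, (((-1) ^ j * Ring.choose α j : ℝ) : ℂ) *
        Complex.exp ((-(h * ((∑ i, k i : ℤ) : ℝ)) : ℝ) * Complex.I) ^ j) * coeff f k := by
  set c : ℕ → Torus d := fun j _ => ((j * h : ℝ) : AddCircle (2 * Real.pi)) with hc
  set F : ℕ → Torus d → ℂ := fun j x =>
    ((((-1) ^ j * Ring.choose α j : ℝ) : ℂ) * f (x - c j)) * (starRingEnd ℂ) (expo k x) with hF
  have hint : ∀ j, Integrable (F j) := fun j =>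
    integrable_mul_conj_expo ((hf.comp_sub_right (c j)).const_mul _) k
  have hnorm : ∀ j, ∫ x, ‖F j x‖ = |Ring.choose α j| * ∫ x, ‖f x‖ := by
    intro j
    have : ∀ x, ‖F j x‖ = |Ring.choose α j| * ‖f (x - c j)‖ := fun x => by
      rw [hF]
      simp only [norm_mul, RCLike.norm_conj, norm_expo, mul_one, Complex.norm_real,
        Real.norm_eq_abs, abs_pow, abs_neg, abs_one, one_pow, one_mul]
    simp_rw [this]
    rw [integral_const_mul, integral_sub_right_eq_self (fun x => ‖f x‖)]
  have hsum : Summable fun j => ∫ x, ‖F j x‖ := by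
    simp_rw [hnorm]
    exact (summable_abs_choose hα).mul_right _
  have key := integral_tsum_of_summable_integral_norm hint hsum
  have hterm : ∀ j, ((((2 * Real.pi) ^ d)⁻¹ : ℝ) : ℂ) * ∫ x, F j x =
      ((((-1) ^ j * Ring.choose α j : ℝ) : ℂ) *
        Complex.exp ((-(h * ((∑ i, k i : ℤ) : ℝ)) : ℝ) * Complex.I) ^ j) * coeff f k := by
    intro j
    have h1 := coeff_smul (((-1) ^ j * Ring.choose α j : ℝ) : ℂ) (fun x => f (x - c j)) k
    rw [coeff_translate, conj_expo_diag, ← mul_assoc] at h1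
    exact h1
  rw [← tsum_mul_right, ← tsum_congr hterm, tsum_mul_left, key]
  unfold coeff fracDiff
  congr 2
  ext x
  rw [← tsum_mul_right]
  rfl

theorem norm_coeff_fracDiff {α : ℝ} (hα : 0 < α) (h : ℝ) {f : Torus d → ℂ} (hf : Integrable f)
    (k : Fin d → ℤ) :
    ‖coeff (fracDiff α h f) k‖ =
      (2 * (1 - Real.cos (h * ((∑ i, k i : ℤ) : ℝ)))) ^ (α / 2) * ‖coeff f k‖ := by
  rw [coeff_fracDiff hα h hf, norm_mul, norm_binomial_tsum hα, norm_one_sub_exp_rpow, Real.cos_neg]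
  rw [Complex.norm_exp_ofReal_mul_I]

theorem spNorm_rpow {p : ℝ} (hp : 0 < p) (f : Torus d → ℂ) :
    spNorm p f ^ p = ∑' k : Fin d → ℤ, ENNReal.ofReal (‖coeff f k‖ ^ p) := by
  rw [spNorm, one_div, ENNReal.rpow_inv_rpow hp.ne']

/-- The role of `Y`: no cancellation occurs in `∑ k_i`, so the frequency seen by the difference is
the one that governs triangular approximation. -/
theorem abs_sum_eq_l1 {k : Fin d → ℤ} (hk : k ∈ specY d) :
    |∑ i, k i| = (l1 k : ℤ) := by
  rcases hk with hk | hk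
  · rw [abs_of_nonneg (Finset.sum_nonneg fun i _ => hk i), l1]
    push_cast
    exact Finset.sum_congr rfl fun i _ => (abs_of_nonneg (hk i)).symm
  · rw [abs_of_nonpos (Finset.sum_nonpos fun i _ => (hk i).le), l1, ← Finset.sum_neg_distrib]
    push_cast
    exact Finset.sum_congr rfl fun i _ => (abs_of_neg (hk i)).symm

theorem spNorm_fracDiff_rpow {p α : ℝ} (hp : 0 < p) (hα : 0 < α) (h : ℝ) {f : Torus d → ℂ}
    (hf : Integrable f) (hY : HasSpecY f) :
    spNorm p (fracDiff α h f) ^ p = ∑' k : Fin d → ℤ,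
      ENNReal.ofReal ((2 * (1 - Real.cos (l1 k * h))) ^ (α * p / 2)) *
        ENNReal.ofReal (‖coeff f k‖ ^ p) := by
  rw [spNorm_rpow hp]
  refine tsum_congr fun k => ?_
  have h0 : ∀ x : ℝ, 0 ≤ 2 * (1 - Real.cos x) := fun x => by linarith [Real.cos_le_one x]
  rw [norm_coeff_fracDiff hα h hf]
  by_cases hk : k ∈ specY d
  · have hcos : Real.cos (h * ((∑ i, k i : ℤ) : ℝ)) = Real.cos (l1 k * h) := by
      have h2 : |((∑ i, k i : ℤ) : ℝ)| = (l1 k : ℝ) := by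
        have := congrArg (Int.cast : ℤ → ℝ) (abs_sum_eq_l1 hk)
        rwa [Int.cast_abs, Int.cast_natCast] at this
      rw [← Real.cos_abs, abs_mul, h2, ← Real.cos_abs (_ * h), abs_mul, Nat.abs_cast, mul_comm]
    rw [hcos, ← ENNReal.ofReal_mul (Real.rpow_nonneg (h0 _) _),
      Real.mul_rpow (Real.rpow_nonneg (h0 _) _) (norm_nonneg _), ← Real.rpow_mul (h0 _)]
    congr 3
    ring
  · simp [hY k hk, Real.zero_rpow hp.ne']

theorem finite_l1_le (m : ℕ) : {k : Fin d → ℤ | l1 k ≤ m}.Finite := by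
  refine (Set.finite_Icc (fun _ : Fin d => -(m : ℤ)) (fun _ => (m : ℤ))).subset fun k hk => ?_
  have h : ∀ i, (k i).natAbs ≤ m := fun i =>
    (Finset.single_le_sum (f := fun i => (k i).natAbs) (fun _ _ => Nat.zero_le _)
      (Finset.mem_univ i)).trans hk
  exact ⟨fun i => by have := h i; simp only; omega, fun i => by have := h i; simp only; omega⟩

theorem integrable_and_coeff_eq_zero_of_mem_triPoly {m : ℕ} {g : Torus d → ℂ}
    (hg : g ∈ triPoly d m) : Integrable g ∧ ∀ k, m < l1 k → coeff g k = 0 := by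
  refine Submodule.span_induction (p := fun g _ => Integrable g ∧ ∀ k, m < l1 k → coeff g k = 0)
    ?_ ?_ ?_ ?_ hg
  · rintro _ ⟨j, hj, rfl⟩
    refine ⟨integrable_expo j, fun k hk => ?_⟩
    rw [coeff_expo, if_neg]
    rintro rfl
    exact absurd hj (not_le.2 hk)
  · exact ⟨integrable_zero _ _ _, fun k _ => by simp [coeff]⟩
  · rintro x y _ _ ⟨hx, hx'⟩ ⟨hy, hy'⟩
    exact ⟨hx.add hy, fun k hk => by rw [coeff_add hx hy, hx' k hk, hy' k hk, add_zero]⟩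
  · rintro a x _ ⟨hx, hx'⟩
    exact ⟨hx.smul a, fun k hk => by rw [coeff_smul, hx' k hk, mul_zero]⟩

/-- The Fourier partial sum is optimal: a triangular polynomial cannot change the coefficients with
`|k|_1 ≥ n`, and the partial sum kills all others. -/
theorem bestApprox_rpow {p : ℝ} (hp : 0 < p) {n : ℕ} (hn : 1 ≤ n) {f : Torus d → ℂ}
    (hf : Integrable f) :
    bestApprox p n f ^ p = ∑' k : Fin d → ℤ,
      if n ≤ l1 k then ENNReal.ofReal (‖coeff f k‖ ^ p) else 0 := by
  apply le_antisymm
  · set s := (finite_l1_le (d := d) (n - 1)).toFinset with hs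
    obtain ⟨hgi, hgc⟩ := coeff_sum_expo s (coeff f)
    have hg : (∑ m ∈ s, coeff f m • expo m : Torus d → ℂ) ∈ triPoly d (n - 1) := by
      refine Submodule.sum_mem _ fun m hm => Submodule.smul_mem _ _ (Submodule.subset_span ⟨m, ?_, rfl⟩)
      simpa [hs] using hm
    calc bestApprox p n f ^ p ≤ spNorm p (f - ∑ m ∈ s, coeff f m • expo m) ^ p :=
          ENNReal.rpow_le_rpow (iInf₂_le _ hg) hp.le
      _ = _ := by
          rw [spNorm_rpow hp]
          refine tsum_congr fun k => ?_
          rw [coeff_sub hf hgi, hgc]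
          have : k ∈ s ↔ ¬ n ≤ l1 k := by
            simp only [hs, Finite.mem_toFinset, mem_ofPred_eq]; omega
          by_cases h : n ≤ l1 k
          · rw [if_neg (by rw [this]; exact not_not.2 h), if_pos h, sub_zero]
          · rw [if_pos (this.2 h), if_neg h, sub_self]
            simp [Real.zero_rpow hp.ne']
  · rw [← ENNReal.rpow_inv_le_iff hp, bestApprox]
    refine le_iInf₂ fun g hg => ?_
    rw [ENNReal.rpow_inv_le_iff hp, spNorm_rpow hp]
    refine ENNReal.tsum_le_tsum fun k => ?_
    split_ifs with h
    · obtain ⟨hgi, hgc⟩ := integrable_and_coeff_eq_zero_of_mem_triPoly hg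
      rw [coeff_sub hf hgi, hgc k (by omega), sub_zero]
    · exact zero_le

/-! ### Lebesgue-Stieltjes measures on `[0, τ]` -/

open Filter Topology in
theorem rightLim_congr {f g : ℝ → ℝ} {x : ℝ} (h : f =ᶠ[𝓝[>] x] g) {y : ℝ}
    (hg : Tendsto g (𝓝[>] x) (𝓝 y)) : Function.rightLim f x = y :=
  rightLim_eq_of_tendsto (hg.congr' h.symm)

theorem monotone_clampExt {τ : ℝ} (hτ : 0 ≤ τ) {μ : ℝ → ℝ} (h : MonotoneOn μ (Icc 0 τ)) :
    Monotone (clampExt τ μ) := fun _ _ hst =>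
  h ⟨le_max_left _ _, max_le hτ (min_le_left _ _)⟩ ⟨le_max_left _ _, max_le hτ (min_le_left _ _)⟩
    (max_le_max le_rfl (min_le_min le_rfl hst))

open Filter Topology in
theorem stieltjesMeasure_Icc {τ : ℝ} (hτ : 0 ≤ τ) {μ : ℝ → ℝ} (h : MonotoneOn μ (Icc 0 τ)) :
    stieltjesMeasure τ μ (Icc 0 τ) = ENNReal.ofReal (μ τ - μ 0) := by
  have hm := monotone_clampExt hτ h
  rw [stieltjesMeasure, dif_pos hm, StieltjesFunction.measure_Icc]
  have h1 : hm.stieltjesFunction τ = μ τ := by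
    rw [hm.stieltjesFunction_eq]
    refine rightLim_congr (g := fun _ => μ τ) ?_ tendsto_const_nhds
    filter_upwards [self_mem_nhdsWithin] with t ht
    rw [clampExt, min_eq_left (le_of_lt ht), max_eq_right hτ]
  have h2 : ∀ t < 0, hm.stieltjesFunction t = μ 0 := fun t ht => by
    rw [hm.stieltjesFunction_eq]
    refine rightLim_congr (g := fun _ => μ 0) ?_ tendsto_const_nhds
    filter_upwards [Ioo_mem_nhdsGT ht] with s hs
    rw [clampExt, max_eq_left ((min_le_right _ _).trans hs.2.le)]
  have h3 : Function.leftLim hm.stieltjesFunction 0 = μ 0 := by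
    refine leftLim_eq_of_tendsto
      (tendsto_const_nhds.congr' (f₁ := fun _ => μ 0) ?_)
    filter_upwards [self_mem_nhdsWithin] with t ht
    exact (h2 t ht).symm
  rw [h1, h3]

theorem sub_pos_of_mem_admissible {τ : ℝ} (hτ : 0 ≤ τ) {μ : ℝ → ℝ} (h : μ ∈ admissible τ) :
    0 < μ τ - μ 0 := by
  by_contra! hle
  refine h.2 ⟨μ 0, fun t ht => le_antisymm ?_ ?_⟩
  · linarith [h.1 ht ⟨hτ, le_rfl⟩ ht.2]
  · exact h.1 ⟨le_rfl, hτ⟩ ht ht.1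

open Filter Topology ProbabilityTheory in
theorem exists_admissible_stieltjesMeasure_eq {τ : ℝ} (hτ : 0 < τ) (m : Measure ℝ)
    [IsProbabilityMeasure m] (hm : m (Icc 0 τ)ᶜ = 0) :
    ∃ μ ∈ admissible τ, stieltjesMeasure τ μ = m ∧ μ τ - μ 0 = 1 := by
  -- The distribution function is reset to `0` at `t = 0`, so that an atom of `m` at `0` becomes a
  -- jump counted in `μ τ - μ 0`. The Stieltjes function takes right limits and does not see the
  -- change.
  set μ : ℝ → ℝ := fun t => if t ≤ 0 then 0 else cdf m t with hμ
  have hmono : Monotone μ := by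
    intro s t hst
    simp only [hμ]
    split_ifs with h1 h2 h2
    · exact le_rfl
    · exact cdf_nonneg m t
    · exact absurd (hst.trans h2) h1
    · exact monotone_cdf m hst
  have hge : ∀ t, τ ≤ t → cdf m t = 1 := by
    intro t ht
    rw [cdf_eq_real, measureReal_def, (prob_compl_eq_zero_iff measurableSet_Iic).1, ENNReal.toReal_one]
    refine measure_mono_null (fun s hs => ?_) hm
    simp only [mem_compl_iff, mem_Iic, not_le] at hs
    exact fun h => absurd h.2 (not_le.2 (ht.trans_lt hs))
  have hlt : ∀ t < 0, cdf m t = 0 := by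
    intro t ht
    rw [cdf_eq_real, measureReal_def, measure_mono_null (fun s hs => ?_) hm, ENNReal.toReal_zero]
    exact fun h => absurd (h.1.trans hs) (not_le.2 ht)
  have h0 : μ 0 = 0 := by simp [hμ]
  have h1 : μ τ = 1 := by simp [hμ, hτ, hge]
  refine ⟨μ, ⟨hmono.monotoneOn _, ?_⟩, ?_, by rw [h0, h1, sub_zero]⟩
  · rintro ⟨c, hc⟩
    have e0 := hc 0 ⟨le_rfl, hτ.le⟩
    have e1 := hc τ ⟨hτ.le, le_rfl⟩
    linarith
  have hcl := monotone_clampExt hτ.le (hmono.monotoneOn (Icc 0 τ))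
  have hext : ∀ t, t ≠ 0 → clampExt τ μ t = cdf m t := by
    intro t ht
    rcases lt_or_gt_of_ne ht with ht | ht
    · rw [clampExt, max_eq_left ((min_le_right _ _).trans ht.le), h0, hlt t ht]
    · rcases le_total t τ with htτ | htτ
      · rw [clampExt, min_eq_right htτ, max_eq_right ht.le]
        simp [hμ, ht]
      · rw [clampExt, min_eq_left htτ, max_eq_right hτ.le, h1, hge t htτ]
  have heq : hcl.stieltjesFunction = cdf m := by
    ext x
    rw [hcl.stieltjesFunction_eq]
    refine rightLim_congr (g := cdf m) ?_
      (((cdf m).right_continuous x).mono Ioi_subset_Ici_self)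
    have : ∀ᶠ t in 𝓝[>] x, t ≠ 0 := by
      rcases le_or_gt 0 x with hx | hx
      · filter_upwards [self_mem_nhdsWithin] with t ht using (hx.trans_lt ht).ne'
      · filter_upwards [Ioo_mem_nhdsGT hx] with t ht using ht.2.ne
    filter_upwards [this] with t ht using hext t ht
  rw [stieltjesMeasure, dif_pos hcl, heq, measure_cdf]

/-! ### A uniform lower bound for the means of `(1 - cos (s t)) ^ β` -/

theorem sin_le_of_mem_Ioc {x : ℝ} (h0 : 0 < x) (h1 : x ≤ 1) : Real.sin x ≤ x - x ^ 3 / 12 := by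
  have h := abs_le.1 (Real.sin_bound (x := x) (by rwa [abs_of_pos h0]))
  rw [abs_of_pos h0] at h
  have : x ^ 5 ≤ x ^ 3 := pow_le_pow_of_le_one h0.le h1 (by norm_num)
  have h3 : 0 < x ^ 3 := by positivity
  linarith [h.2]

theorem exists_sin_le_mul {τ : ℝ} (hτ : 0 < τ) :
    ∃ δ > 0, δ < 1 ∧ ∀ x, τ ≤ x → Real.sin x ≤ (1 - δ) * x := by
  have hm : 0 < min τ 1 := lt_min hτ one_pos
  have hm1 : min τ 1 ^ 2 ≤ 1 := pow_le_one₀ hm.le (min_le_right _ _)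
  -- The 48 comes from the range `1 < x ≤ 2`, where `sin x ≤ 2 sin(x/2) ≤ x - 2(x/2)^3/12 = x -
  -- x^3/48`.
  refine ⟨min τ 1 ^ 2 / 48, by positivity, by linarith, fun x hx => ?_⟩
  have hx0 : 0 < x := hτ.trans_le hx
  have hd : min τ 1 ^ 2 / 48 * x ≤ 1 / 48 * x := by gcongr
  rcases le_or_gt x 1 with h1 | h1
  · have h := sin_le_of_mem_Ioc hx0 h1
    have : min τ 1 ^ 2 * x ≤ x ^ 2 * x := by
      gcongr
      exact (min_le_left _ _).trans hx
    nlinarith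
  rcases le_or_gt x 2 with h2 | h2
  · have h := sin_le_of_mem_Ioc (x := x / 2) (by linarith) (by linarith)
    have hs : 0 ≤ Real.sin (x / 2) :=
      Real.sin_nonneg_of_nonneg_of_le_pi (by linarith) (by linarith [Real.pi_gt_three])
    have hdb : Real.sin x = 2 * Real.sin (x / 2) * Real.cos (x / 2) := by
      rw [← Real.sin_two_mul]; congr 1; ring
    have hle : Real.sin x ≤ 2 * Real.sin (x / 2) := by
      rw [hdb]
      exact mul_le_of_le_one_right (by linarith) (Real.cos_le_one _)
    have : x ≤ x ^ 3 := le_self_pow₀ h1.le (by norm_num)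
    nlinarith
  · nlinarith [Real.sin_le_one x]

/-- With `y = (1 - cos(st))/2 ∈ [0, 1]` and an integer `N ≥ β`, `y^β ≥ y^N`, and Bernoulli's
inequality bounds `y^N` below by its tangent at `c = δ/2`. The tangent is affine in `cos(st)`, hence
integrable explicitly; the mean of `y` is at least `c` because `sin(sτ) ≤ (1 - δ)sτ` uniformly in `s
≥ 1`. -/
theorem exists_le_integral_one_sub_cos_rpow {τ : ℝ} (hτ : 0 < τ) {β : ℝ} (hβ : 0 < β) :
    ∃ ε > 0, ∀ s : ℝ, 1 ≤ s → ε ≤ ∫ t in (0)..τ, (2 * (1 - Real.cos (s * t))) ^ β := by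
  obtain ⟨δ, hδ, hδ1, hsin⟩ := exists_sin_le_mul hτ
  obtain ⟨N, hN⟩ := exists_nat_ge β
  have hN0 : 0 < (N : ℝ) := hβ.trans_le hN
  set c : ℝ := δ / 2 with hc
  have hc0 : 0 < c := by positivity
  refine ⟨c ^ N * τ, by positivity, fun s hs => ?_⟩
  have hs0 : 0 < s := one_pos.trans_le hs
  have hpt : ∀ t : ℝ, c ^ N * (1 + N * ((1 - Real.cos (s * t)) / 2 / c - 1)) ≤
      (2 * (1 - Real.cos (s * t))) ^ β := by
    intro t
    set y := (1 - Real.cos (s * t)) / 2 with hy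
    have hy0 : 0 ≤ y := by linarith [Real.cos_le_one (s * t)]
    have hy1 : y ≤ 1 := by linarith [Real.neg_one_le_cos (s * t)]
    have hb := one_add_mul_le_pow (a := y / c - 1) (by have : 0 ≤ y / c := by positivity
                                                       linarith) N
    calc c ^ N * (1 + N * (y / c - 1)) ≤ c ^ N * (1 + (y / c - 1)) ^ N := by gcongr
      _ = y ^ N := by rw [← mul_pow]; congr 1; field_simp; ring
      _ = y ^ (N : ℝ) := (Real.rpow_natCast _ _).symm
      _ ≤ y ^ β := Real.rpow_le_rpow_of_exponent_ge' hy0 hy1 hβ.le hN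
      _ ≤ (2 * (1 - Real.cos (s * t))) ^ β := by
          apply Real.rpow_le_rpow hy0 _ hβ.le
          linarith
  have hcont : Continuous fun t : ℝ => (2 * (1 - Real.cos (s * t))) ^ β :=
    Continuous.rpow_const (by fun_prop) fun _ => Or.inr hβ.le
  refine le_trans ?_ (intervalIntegral.integral_mono_on hτ.le
    (Continuous.intervalIntegrable (by fun_prop) _ _) (hcont.intervalIntegrable _ _)
    fun t _ => hpt t)
  have hcos : ∫ t in (0)..τ, Real.cos (s * t) = Real.sin (s * τ) / s := by
    rw [intervalIntegral.integral_comp_mul_left _ hs0.ne', integral_cos]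
    simp [div_eq_inv_mul]
  have hval : ∫ t in (0)..τ, c ^ N * (1 + N * ((1 - Real.cos (s * t)) / 2 / c - 1)) =
      c ^ N * (τ + N * ((τ - Real.sin (s * τ) / s) / 2 / c - τ)) := by
    have hi : IntervalIntegrable (fun t => Real.cos (s * t)) volume 0 τ :=
      Continuous.intervalIntegrable (by fun_prop) _ _
    rw [show (fun t => c ^ N * (1 + N * ((1 - Real.cos (s * t)) / 2 / c - 1))) =
      fun t => c ^ N * (1 + N * (1 / 2 / c - 1)) - c ^ N * N / 2 / c * Real.cos (s * t) by
        ext t; ring]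
    rw [intervalIntegral.integral_sub (by simp) (hi.const_mul _),
      intervalIntegral.integral_const, intervalIntegral.integral_const_mul, hcos, smul_eq_mul]
    ring
  rw [hval]
  have h1 : Real.sin (s * τ) / s ≤ (1 - δ) * τ := by
    rw [div_le_iff₀ hs0]
    have := hsin (s * τ) (le_mul_of_one_le_left hτ.le hs)
    linarith
  have h2 : τ ≤ (τ - Real.sin (s * τ) / s) / 2 / c := by
    rw [le_div_iff₀ hc0, hc]
    linarith
  gcongr
  have : 0 ≤ (N : ℝ) * ((τ - Real.sin (s * τ) / s) / 2 / c - τ) :=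
    mul_nonneg hN0.le (by linarith)
  linarith

/-! ### A minimax principle -/

/-- `A` is disjoint from the open convex set of functions lying everywhere below `c`. A functional
separating the two is positive and nonzero, so after normalization it is integration against a
probability measure. -/
theorem exists_probabilityMeasure_le_integral {K : Type*} [TopologicalSpace K] [CompactSpace K]
    [T2Space K] [MeasurableSpace K] [BorelSpace K] {A : Set C(K, ℝ)} (hA : Convex ℝ A)
    (hne : A.Nonempty) {c : ℝ} (h : ∀ g ∈ A, ∃ t, c ≤ g t) :
    ∃ m : Measure K, IsProbabilityMeasure m ∧ ∀ g ∈ A, c ≤ ∫ t, g t ∂m := by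
  have hs : Convex ℝ {g : C(K, ℝ) | ∀ t, g t < c} := by
    intro f hf g hg a b ha hb hab t
    exact convex_Iio c (hf t) (hg t) ha hb hab
  have ho : IsOpen {g : C(K, ℝ) | ∀ t, g t < c} := by
    simpa [MapsTo] using ContinuousMap.isOpen_setOfPred_mapsTo (X := K) isCompact_univ (isOpen_Iio (a := c))
  have hdisj : Disjoint {g : C(K, ℝ) | ∀ t, g t < c} A :=
    Set.disjoint_left.2 fun g hg hgA => by
      obtain ⟨t, ht⟩ := h g hgA
      exact absurd (hg t) (not_lt.2 ht)
  obtain ⟨F, u, hFs, hFA⟩ := geometric_hahn_banach_open hs ho hA hdisj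
  have hconst : ∀ r : ℝ, F (ContinuousMap.const K r) = r * F 1 := fun r => by
    rw [← smul_eq_mul, ← map_smul]
    congr 1
    ext t
    simp
  -- Subtracting multiples of `g ≥ 0` stays in the open set, where `F` is bounded above by `u`; `F g
  -- < 0` would make it unbounded.
  have hpos : ∀ g : C(K, ℝ), (∀ t, 0 ≤ g t) → 0 ≤ F g := by
    intro g hg
    by_contra! hneg
    obtain ⟨N, hN⟩ := exists_nat_gt ((u - F (ContinuousMap.const K (c - 1))) / (-F g))
    have h1 := hFs (ContinuousMap.const K (c - 1) - (N : ℝ) • g) fun t => by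
      have : 0 ≤ (N : ℝ) * g t := mul_nonneg N.cast_nonneg (hg t)
      simp only [ContinuousMap.sub_apply, ContinuousMap.const_apply, ContinuousMap.smul_apply,
        smul_eq_mul]
      linarith
    rw [map_sub, map_smul, smul_eq_mul] at h1
    rw [div_lt_iff₀ (by linarith)] at hN
    linarith
  have hone : 0 < F 1 := by
    refine lt_of_le_of_ne (hpos 1 fun t => zero_le_one) fun h0 => ?_
    have hzero : ∀ g, F g = 0 := by
      intro g
      have h1 := hpos (ContinuousMap.const K ‖g‖ - g) fun t => by
        simpa using (le_abs_self _).trans (g.norm_coe_le_norm t)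
      have h2 := hpos (ContinuousMap.const K ‖g‖ + g) fun t => by
        have := (neg_le_abs _).trans (g.norm_coe_le_norm t)
        simp only [ContinuousMap.add_apply, ContinuousMap.const_apply]
        linarith
      rw [map_sub, hconst, ← h0] at h1
      rw [map_add, hconst, ← h0] at h2
      linarith
    obtain ⟨g, hg⟩ := hne
    have h1 := hFA g hg
    have h2 := hFs (ContinuousMap.const K (c - 1)) fun t => by simp
    rw [hzero] at h1 h2
    linarith
  let Λ : CompactlySupportedContinuousMap K ℝ →ₚ[ℝ] ℝ :=
  { toFun g := (F 1)⁻¹ * F g.toContinuousMap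
    map_add' g g' := by
      rw [show (g + g').toContinuousMap = g.toContinuousMap + g'.toContinuousMap from rfl, map_add,
        mul_add]
    map_smul' r g := by
      rw [show (r • g).toContinuousMap = r • g.toContinuousMap from rfl, map_smul]
      simp only [smul_eq_mul, RingHom.id_apply]
      ring
    monotone' g g' hgg' := by
      refine mul_le_mul_of_nonneg_left ?_ (by positivity)
      have := hpos (g'.toContinuousMap - g.toContinuousMap) fun t => by
        simpa using hgg' t
      rw [map_sub] at this
      exact sub_nonneg.1 this }
  have hint : ∀ g : C(K, ℝ), ∫ t, g t ∂(RealRMK.rieszMeasure Λ) = (F 1)⁻¹ * F g := fun g =>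
    RealRMK.integral_rieszMeasure Λ ⟨g, HasCompactSupport.of_compactSpace _⟩
  refine ⟨RealRMK.rieszMeasure Λ, ⟨?_⟩, fun g hg => ?_⟩
  · have := hint 1
    simp only [ContinuousMap.one_apply, integral_const, smul_eq_mul, mul_one,
      inv_mul_cancel₀ hone.ne'] at this
    rwa [measureReal_def, ENNReal.toReal_eq_one_iff] at this
  · rw [hint, ← div_eq_inv_mul, le_div_iff₀ hone]
    refine le_of_forall_pos_lt_add fun ε hε => ?_
    -- Constants just below `c` lie in the open set, which forces `c * F 1 ≤ u` in the limit.
    have h1 := hFs (ContinuousMap.const K (c - ε / F 1)) fun t => by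
      simpa using div_pos hε hone
    rw [hconst, sub_mul, div_mul_cancel₀ _ hone.ne'] at h1
    linarith [hFA g hg]

/-- Finitely supported probability weights. -/
def weights (ι : Type*) : Set (ι →₀ ℝ) := {w | (∀ i, 0 ≤ w i) ∧ (w.sum fun _ a => a) = 1}

theorem convex_weights (ι : Type*) : Convex ℝ (weights ι) := by
  intro v hv w hw a b ha hb hab
  refine ⟨fun i => ?_, ?_⟩
  · have := mul_nonneg ha (hv.1 i)
    have := mul_nonneg hb (hw.1 i)
    simp only [Finsupp.add_apply, Finsupp.smul_apply, smul_eq_mul]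
    linarith
  · rw [Finsupp.sum_add_index' (fun _ => rfl) (fun _ _ _ => rfl),
      Finsupp.sum_smul_index fun _ => rfl, Finsupp.sum_smul_index fun _ => rfl,
      ← Finsupp.mul_sum, ← Finsupp.mul_sum, hv.2, hw.2, mul_one, mul_one, hab]

theorem single_mem_weights {ι : Type*} (i : ι) : Finsupp.single i 1 ∈ weights ι := by
  refine ⟨fun j => ?_, by simp⟩
  classical
  rw [Finsupp.single_apply]
  split_ifs <;> norm_num

/-- The game with payoffs `φ i t`, `t ∈ [0, τ]`, has a value `c`, and the maximizing `t`-player has an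
optimal mixed strategy. -/
theorem exists_minimax {ι : Type*} [Nonempty ι] {τ : ℝ} (φ : ι → ℝ → ℝ)
    (hφ : ∀ i, Continuous (φ i)) {m₀ : Measure ℝ} [IsProbabilityMeasure m₀]
    (hm₀ : m₀ (Icc 0 τ)ᶜ = 0) {ε : ℝ} (hε : 0 < ε) (hint : ∀ i, ε ≤ ∫ t in Icc 0 τ, φ i t ∂m₀) :
    ∃ c > 0, (∃ m : Measure ℝ, IsProbabilityMeasure m ∧ m (Icc 0 τ)ᶜ = 0 ∧
        ∀ i, c ≤ ∫ t in Icc 0 τ, φ i t ∂m) ∧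
      ∀ b > c, ∃ w ∈ weights ι, ∀ t ∈ Icc 0 τ, (w.sum fun i a => a * φ i t) ≤ b := by
  -- `S` consists of the payoff bounds that the `ν`-player can guarantee; the value is `sInf S`,
  -- positive because `m₀` earns at least `ε` against every mixture.
  set S : Set ℝ := {b | ∃ w ∈ weights ι, ∀ t ∈ Icc 0 τ, (w.sum fun i a => a * φ i t) ≤ b} with hS
  have hmass : m₀ (Icc 0 τ) = 1 := (prob_compl_eq_zero_iff measurableSet_Icc).1 hm₀
  have hlow : ∀ b ∈ S, ε ≤ b := by
    rintro b ⟨w, hw, hb⟩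
    have hi : ∀ i, IntegrableOn (φ i) (Icc 0 τ) m₀ := fun i =>
      (hφ i).continuousOn.integrableOn_compact isCompact_Icc
    calc ε = w.sum fun i a => a * ε := by rw [← Finsupp.sum_mul, hw.2, one_mul]
      _ ≤ w.sum fun i a => a * ∫ t in Icc 0 τ, φ i t ∂m₀ :=
          Finset.sum_le_sum fun i _ => mul_le_mul_of_nonneg_left (hint i) (hw.1 i)
      _ = ∫ t in Icc 0 τ, (w.sum fun i a => a * φ i t) ∂m₀ := by
          simp only [Finsupp.sum]
          rw [integral_finsetSum _ fun i _ => (hi i).const_mul _]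
          simp_rw [integral_const_mul]
      _ ≤ ∫ t in Icc 0 τ, b ∂m₀ := by
          refine setIntegral_mono_on ?_ (integrableOn_const (by simp)) measurableSet_Icc hb
          exact integrable_finsetSum _ fun i _ => (hi i).const_mul _
      _ = b := by simp [measureReal_def, hmass]
  have hSne : S.Nonempty := by
    obtain ⟨i⟩ := ‹Nonempty ι›
    obtain ⟨b, hb⟩ := (isCompact_Icc (a := (0 : ℝ)) (b := τ)).bddAbove_image (hφ i).continuousOn
    exact ⟨b, _, single_mem_weights i, fun t ht => by simpa using hb ⟨t, ht, rfl⟩⟩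
  have hSb : BddBelow S := ⟨ε, hlow⟩
  refine ⟨sInf S, hε.trans_le (le_csInf hSne hlow), ?_, fun b hb => ?_⟩
  · let ψ : ι → C(Icc (0 : ℝ) τ, ℝ) := fun i => ⟨fun t => φ i t, by fun_prop⟩
    have hval : ∀ (w : ι →₀ ℝ) (t : Icc (0 : ℝ) τ), Finsupp.linearCombination ℝ ψ w t =
        w.sum fun i a => a * φ i t := fun w t => by
      simp [Finsupp.linearCombination_apply, Finsupp.sum, ContinuousMap.sum_apply, ψ]
    have hneIcc : (Icc (0 : ℝ) τ).Nonempty := by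
      by_contra hempty
      rw [not_nonempty_iff_eq_empty.1 hempty, measure_empty] at hmass
      exact zero_ne_one hmass
    obtain ⟨m, hm, hmA⟩ := exists_probabilityMeasure_le_integral (c := sInf S)
      ((convex_weights ι).linear_image (Finsupp.linearCombination ℝ ψ))
      ⟨_, _, single_mem_weights (Classical.arbitrary ι), rfl⟩ (by
        rintro _ ⟨w, hw, rfl⟩
        have : Nonempty (Icc (0 : ℝ) τ) := hneIcc.to_subtype
        obtain ⟨t, -, ht⟩ := isCompact_univ.exists_isMaxOn univ_nonempty
          (Finsupp.linearCombination ℝ ψ w).continuous.continuousOn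
        -- The maximum of a mixture over `[0, τ]` is itself a guaranteed bound, hence at least `sInf
        -- S`.
        refine ⟨t, csInf_le hSb ⟨w, hw, fun s hs => ?_⟩⟩
        rw [← hval w ⟨s, hs⟩]
        exact ht (mem_univ _))
    have hmap : (m.map Subtype.val) (Icc 0 τ)ᶜ = 0 := by
      rw [Measure.map_apply measurable_subtype_coe measurableSet_Icc.compl]
      simp
    refine ⟨m.map Subtype.val, Measure.isProbabilityMeasure_map measurable_subtype_coe.aemeasurable,
      hmap, fun i => ?_⟩
    rw [Measure.restrict_eq_self_of_ae_mem (s := Icc 0 τ) hmap,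
      integral_map measurable_subtype_coe.aemeasurable (hφ i).aestronglyMeasurable]
    have := hmA (ψ i) ⟨_, single_mem_weights i, by simp⟩
    exact this
  · obtain ⟨b', ⟨w, hw, hb'⟩, hlt⟩ := exists_lt_of_csInf_lt hSne hb
    exact ⟨w, hw, fun t ht => (hb' t ht).trans hlt.le⟩

/-! ### The Jackson inequality -/

theorem two_mul_one_sub_cos_nonneg (x : ℝ) : 0 ≤ 2 * (1 - Real.cos x) := by
  linarith [Real.cos_le_one x]

theorem continuous_two_mul_one_sub_cos_rpow {β : ℝ} (hβ : 0 < β) (s : ℝ) :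
    Continuous fun t : ℝ => (2 * (1 - Real.cos (s * t))) ^ β :=
  Continuous.rpow_const (by fun_prop) fun _ => Or.inr hβ.le

theorem two_rpow_mul_infIntegral_le (n : ℕ) (α p τ : ℝ) (μ : ℝ → ℝ) {ν : ℕ} (hν : n ≤ ν) :
    2 ^ (α * p / 2) * infIntegral n α p τ μ ≤
      ∫ t in Icc 0 τ, (2 * (1 - Real.cos ((ν : ℕ) / n * t))) ^ (α * p / 2) ∂stieltjesMeasure τ μ := by
  have h0 : ∀ x, 0 ≤ 1 - Real.cos x := fun x => by linarith [Real.cos_le_one x]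
  simp_rw [Real.mul_rpow zero_le_two (h0 _)]
  rw [integral_const_mul]
  refine mul_le_mul_of_nonneg_left ?_ (by positivity)
  refine ciInf_le ⟨0, ?_⟩ (⟨ν, hν⟩ : {ν : ℕ // n ≤ ν})
  rintro _ ⟨i, rfl⟩
  exact integral_nonneg fun t => Real.rpow_nonneg (h0 _) _

theorem le_two_rpow_mul_infIntegral {n : ℕ} {α p τ : ℝ} {μ : ℝ → ℝ} {c : ℝ}
    (h : ∀ ν : {ν : ℕ // n ≤ ν}, c ≤
      ∫ t in Icc 0 τ, (2 * (1 - Real.cos ((ν : ℕ) / n * t))) ^ (α * p / 2) ∂stieltjesMeasure τ μ) :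
    c ≤ 2 ^ (α * p / 2) * infIntegral n α p τ μ := by
  have h0 : ∀ x, 0 ≤ 1 - Real.cos x := fun x => by linarith [Real.cos_le_one x]
  have h2 : (0 : ℝ) < 2 ^ (α * p / 2) := by positivity
  have : Nonempty {ν : ℕ // n ≤ ν} := ⟨⟨n, le_rfl⟩⟩
  rw [← div_le_iff₀' h2]
  refine le_ciInf fun ν => ?_
  rw [div_le_iff₀' h2, ← integral_const_mul]
  simp_rw [← Real.mul_rpow zero_le_two (h0 _)]
  exact h ν

theorem spNorm_fracDiff_le_modulus {p α t : ℝ} {f : Torus d → ℂ} {h : ℝ} (hh : |h| ≤ t) :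
    spNorm p (fracDiff α h f) ≤ modulus p α f t :=
  le_iSup₂ (f := fun h (_ : h ∈ {h : ℝ | |h| ≤ t}) => spNorm p (fracDiff α h f)) h hh

/-- The averaging argument: for each `t` the modulus dominates the difference of step `t/n`;
integrate over `dμ` and exchange sum and integral. No division is made, so a vanishing `infIntegral`
is allowed. -/
theorem mul_bestApprox_rpow_le {p α τ : ℝ} (hp : 0 < p) (hα : 0 < α) (hτ : 0 < τ) {n : ℕ}
    (hn : 1 ≤ n) {μ : ℝ → ℝ} (hμ : μ ∈ admissible τ) {f : Torus d → ℂ} (hf : Integrable f)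
    (hY : HasSpecY f) :
    ENNReal.ofReal (2 ^ (α * p / 2) * infIntegral n α p τ μ) * bestApprox p n f ^ p ≤
      ENNReal.ofReal (μ τ - μ 0) * modulus p α f (τ / n) ^ p := by
  have hβ : 0 < α * p / 2 := by positivity
  have hn0 : (0 : ℝ) < n := by exact_mod_cast hn
  have hmass := stieltjesMeasure_Icc hτ.le hμ.1
  have hcont : ∀ ν : ℕ, Continuous fun t : ℝ =>
      (2 * (1 - Real.cos ((ν : ℕ) / n * t))) ^ (α * p / 2) := fun ν =>
    continuous_two_mul_one_sub_cos_rpow hβ _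
  have hfin : IsFiniteMeasure ((stieltjesMeasure τ μ).restrict (Icc 0 τ)) :=
    ⟨by rw [Measure.restrict_apply_univ, hmass]; exact ENNReal.ofReal_lt_top⟩
  have hint : ∀ ν : ℕ, IntegrableOn (fun t : ℝ =>
      (2 * (1 - Real.cos ((ν : ℕ) / n * t))) ^ (α * p / 2)) (Icc 0 τ) (stieltjesMeasure τ μ) := by
    intro ν
    refine Integrable.of_bound (hcont ν).aestronglyMeasurable (4 ^ (α * p / 2)) (.of_forall fun t => ?_)
    have h0 := two_mul_one_sub_cos_nonneg ((ν : ℕ) / n * t)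
    rw [Real.norm_of_nonneg (Real.rpow_nonneg h0 _)]
    refine Real.rpow_le_rpow h0 ?_ hβ.le
    linarith [Real.neg_one_le_cos ((ν : ℕ) / n * t)]
  calc ENNReal.ofReal (2 ^ (α * p / 2) * infIntegral n α p τ μ) * bestApprox p n f ^ p
      = ∑' k : Fin d → ℤ, ENNReal.ofReal (2 ^ (α * p / 2) * infIntegral n α p τ μ) *
          (if n ≤ l1 k then ENNReal.ofReal (‖coeff f k‖ ^ p) else 0) := by
        rw [bestApprox_rpow hp hn hf, ENNReal.tsum_mul_left]
    _ ≤ ∑' k : Fin d → ℤ, ∫⁻ t in Icc 0 τ,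
          ENNReal.ofReal ((2 * (1 - Real.cos ((l1 k : ℕ) / n * t))) ^ (α * p / 2)) *
            ENNReal.ofReal (‖coeff f k‖ ^ p) ∂stieltjesMeasure τ μ := by
        refine ENNReal.tsum_le_tsum fun k => ?_
        rw [lintegral_mul_const _ (hcont _).measurable.ennreal_ofReal]
        split_ifs with hk
        · gcongr
          rw [← ofReal_integral_eq_lintegral_ofReal (hint _)
            (.of_forall fun t => Real.rpow_nonneg (two_mul_one_sub_cos_nonneg _) _)]
          exact ENNReal.ofReal_le_ofReal (two_rpow_mul_infIntegral_le n α p τ μ hk)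
        · simp
    _ = ∫⁻ t in Icc 0 τ, ∑' k : Fin d → ℤ,
          ENNReal.ofReal ((2 * (1 - Real.cos ((l1 k : ℕ) / n * t))) ^ (α * p / 2)) *
            ENNReal.ofReal (‖coeff f k‖ ^ p) ∂stieltjesMeasure τ μ := by
        rw [lintegral_tsum fun k =>
          ((hcont _).measurable.ennreal_ofReal.mul_const _).aemeasurable]
    _ ≤ ∫⁻ t in Icc 0 τ, modulus p α f (τ / n) ^ p ∂stieltjesMeasure τ μ := by
        refine setLIntegral_mono measurable_const fun t ht => ?_
        have hh : |t / n| ≤ τ / n := by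
          rw [abs_of_nonneg (div_nonneg ht.1 hn0.le)]
          exact div_le_div_of_nonneg_right ht.2 hn0.le
        have := ENNReal.rpow_le_rpow (spNorm_fracDiff_le_modulus (p := p) (α := α) (f := f) hh) hp.le
        rw [spNorm_fracDiff_rpow hp hα _ hf hY] at this
        refine le_trans (le_of_eq (tsum_congr fun k => ?_)) this
        rw [mul_div_assoc', div_mul_eq_mul_div]
    _ = ENNReal.ofReal (μ τ - μ 0) * modulus p α f (τ / n) ^ p := by
        rw [setLIntegral_const, hmass, mul_comm]

/-- Finiteness of the ratio is essential, since `∞ * 0 = 0` when the modulus vanishes. -/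
theorem bestApprox_le_ratio_rpow_mul {p α τ : ℝ} (hp : 0 < p) (hα : 0 < α) (hτ : 0 < τ) {n : ℕ}
    (hn : 1 ≤ n) {μ : ℝ → ℝ} (hμ : μ ∈ admissible τ) (hr : ratio n α p τ μ ≠ ∞) {f : Torus d → ℂ}
    (hf : Integrable f) (hY : HasSpecY f) :
    bestApprox p n f ≤ ratio n α p τ μ ^ (1 / p) * modulus p α f (τ / n) := by
  have hM : ENNReal.ofReal (μ τ - μ 0) ≠ 0 := by
    simpa using sub_pos_of_mem_admissible hτ.le hμ
  have hD : ENNReal.ofReal (2 ^ (α * p / 2) * infIntegral n α p τ μ) ≠ 0 := fun h0 =>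
    hr (by rw [ratio, h0, ENNReal.div_zero hM])
  have h := mul_bestApprox_rpow_le hp hα hτ hn hμ hf hY
  rw [← ENNReal.rpow_le_rpow_iff hp, ENNReal.mul_rpow_of_nonneg _ _ hp.le, one_div,
    ENNReal.rpow_inv_rpow hp.ne', ratio, ENNReal.mul_div_right_comm.symm,
    ENNReal.le_div_iff_mul_le (Or.inl hD) (Or.inl ENNReal.ofReal_ne_top), mul_comm]
  exact h

/-! ### Sharpness -/

/-- Weak duality: the infimum over `ν` is at most the `w`-average of the integrals, which is at most
`b` times the mass of `dμ`. -/
theorem inv_le_ratio {p α τ c : ℝ} (hp : 0 < p) (hα : 0 < α) (hτ : 0 < τ) {n : ℕ} (hc : 0 < c)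
    (h : ∀ b > c, ∃ w ∈ weights {ν : ℕ // n ≤ ν}, ∀ t ∈ Icc 0 τ, (w.sum fun ν a =>
      a * (2 * (1 - Real.cos ((ν : ℕ) / n * t))) ^ (α * p / 2)) ≤ b)
    {μ : ℝ → ℝ} (hμ : μ ∈ admissible τ) : (ENNReal.ofReal c)⁻¹ ≤ ratio n α p τ μ := by
  have hβ : 0 < α * p / 2 := by positivity
  have hmass := stieltjesMeasure_Icc hτ.le hμ.1
  have hM := sub_pos_of_mem_admissible hτ.le hμ
  have hfin : IsFiniteMeasure ((stieltjesMeasure τ μ).restrict (Icc 0 τ)) :=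
    ⟨by rw [Measure.restrict_apply_univ, hmass]; exact ENNReal.ofReal_lt_top⟩
  set D := 2 ^ (α * p / 2) * infIntegral n α p τ μ with hD
  have hle : D ≤ c * (μ τ - μ 0) := by
    rw [← div_le_iff₀ hM]
    refine le_of_forall_gt_imp_ge_of_dense fun b hb => ?_
    rw [div_le_iff₀ hM]
    obtain ⟨w, hw, hwb⟩ := h b hb
    have hi : ∀ ν : {ν : ℕ // n ≤ ν}, Integrable (fun t : ℝ =>
        (2 * (1 - Real.cos ((ν : ℕ) / n * t))) ^ (α * p / 2))
        ((stieltjesMeasure τ μ).restrict (Icc 0 τ)) := fun ν => by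
      refine Integrable.of_bound (continuous_two_mul_one_sub_cos_rpow hβ _).aestronglyMeasurable
        (4 ^ (α * p / 2)) (.of_forall fun t => ?_)
      have h0 := two_mul_one_sub_cos_nonneg ((ν : ℕ) / n * t)
      rw [Real.norm_of_nonneg (Real.rpow_nonneg h0 _)]
      refine Real.rpow_le_rpow h0 ?_ hβ.le
      linarith [Real.neg_one_le_cos ((ν : ℕ) / n * t)]
    calc D = w.sum fun _ a => a * D := by rw [← Finsupp.sum_mul, hw.2, one_mul]
      _ ≤ w.sum fun ν a => a * ∫ t in Icc 0 τ,
          (2 * (1 - Real.cos ((ν : ℕ) / n * t))) ^ (α * p / 2) ∂stieltjesMeasure τ μ :=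
        Finset.sum_le_sum fun ν _ =>
          mul_le_mul_of_nonneg_left (two_rpow_mul_infIntegral_le n α p τ μ ν.2) (hw.1 ν)
      _ = ∫ t in Icc 0 τ, (w.sum fun ν a =>
          a * (2 * (1 - Real.cos ((ν : ℕ) / n * t))) ^ (α * p / 2)) ∂stieltjesMeasure τ μ := by
        simp only [Finsupp.sum]
        rw [integral_finsetSum _ fun ν _ => (hi ν).const_mul _]
        simp_rw [integral_const_mul]
      _ ≤ ∫ t in Icc 0 τ, b ∂stieltjesMeasure τ μ := by
        refine setIntegral_mono_on ?_ (integrable_const _) measurableSet_Icc hwb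
        exact integrable_finsetSum _ fun ν _ => (hi ν).const_mul _
      _ = b * (μ τ - μ 0) := by
        rw [setIntegral_const, measureReal_def, hmass, ENNReal.toReal_ofReal hM.le, smul_eq_mul,
          mul_comm]
  have hM' : ENNReal.ofReal (μ τ - μ 0) ≠ 0 := by simpa using hM
  rw [ratio, ← hD]
  calc (ENNReal.ofReal c)⁻¹
      = ENNReal.ofReal (μ τ - μ 0) / (ENNReal.ofReal c * ENNReal.ofReal (μ τ - μ 0)) := by
        rw [ENNReal.div_eq_inv_mul, ENNReal.mul_inv (Or.inr ENNReal.ofReal_ne_top) (Or.inr hM'),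
          mul_assoc, ENNReal.inv_mul_cancel hM' ENNReal.ofReal_ne_top, mul_one]
    _ ≤ _ := by
        rw [← ENNReal.ofReal_mul hc.le]
        gcongr

/-- The lower bound for the Jackson constant given by lacunary polynomials in one variable. -/
theorem inv_rpow_le_constK (hd : 1 ≤ d) {p α τ b : ℝ} (hp : 0 < p) (hα : 0 < α)
    {n : ℕ} (hn : 1 ≤ n) {w : {ν : ℕ // n ≤ ν} →₀ ℝ} (hw : w ∈ weights {ν : ℕ // n ≤ ν})
    (hwb : ∀ t ∈ Icc 0 τ, (w.sum fun ν a =>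
      a * (2 * (1 - Real.cos ((ν : ℕ) / n * t))) ^ (α * p / 2)) ≤ b) :
    (ENNReal.ofReal b)⁻¹ ^ (1 / p) ≤ constK d n α p τ := by
  classical
  have hn0 : (0 : ℝ) < n := by exact_mod_cast hn
  -- Frequencies `ν e_0` are nonnegative, so they lie in `Y`, and have `|k|_1 = ν ≥ n`.
  set κ : {ν : ℕ // n ≤ ν} → Fin d → ℤ := fun ν => Pi.single ⟨0, hd⟩ ((ν : ℕ) : ℤ) with hκ
  have hκinj : Function.Injective κ := fun x y hxy => by
    have := congrFun hxy ⟨0, hd⟩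
    simp only [hκ, Pi.single_eq_same] at this
    exact Subtype.ext (by exact_mod_cast this)
  have hl1 : ∀ ν, l1 (κ ν) = (ν : ℕ) := fun ν => by
    rw [l1, Finset.sum_eq_single (⟨0, hd⟩ : Fin d)]
    · simp [hκ]
    · intro j _ hj
      simp [hκ, Pi.single_eq_of_ne hj]
    · simp
  -- The exponent `1/p` makes `|f̂|^p` equal to the weights.
  set a : (Fin d → ℤ) → ℂ := Function.extend κ (fun ν => ((w ν ^ (1 / p) : ℝ) : ℂ)) 0 with ha
  have haκ : ∀ ν, a (κ ν) = ((w ν ^ (1 / p) : ℝ) : ℂ) := fun ν => hκinj.extend_apply _ _ ν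
  have ha0 : ∀ k, k ∉ range κ → a k = 0 := fun k hk => Function.extend_apply' _ _ _ hk
  have hanorm : ∀ ν, ‖a (κ ν)‖ ^ p = w ν := fun ν => by
    rw [haκ, Complex.norm_real, Real.norm_of_nonneg (Real.rpow_nonneg (hw.1 ν) _),
      ← Real.rpow_mul (hw.1 ν), one_div_mul_cancel hp.ne', Real.rpow_one]
  set f : Torus d → ℂ := ∑ k ∈ w.support.image κ, a k • expo k with hf
  have hfi : Integrable f := (coeff_sum_expo (w.support.image κ) a).1
  have hfc : ∀ k, coeff f k = a k := fun k => by
    rw [hf, (coeff_sum_expo (w.support.image κ) a).2]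
    split_ifs with hk
    · rfl
    · by_cases hr : k ∈ range κ
      · obtain ⟨ν, rfl⟩ := hr
        have : w ν = 0 := by
          by_contra hne
          exact hk (Finset.mem_image_of_mem κ (Finsupp.mem_support_iff.2 hne))
        rw [haκ, this, Real.zero_rpow (by positivity), Complex.ofReal_zero]
      · rw [ha0 k hr]
  have hY : HasSpecY f := fun k hk => by
    rw [hfc]
    refine ha0 k fun ⟨ν, hν⟩ => hk (Or.inl fun j => ?_)
    rw [← hν]
    by_cases hj : j = ⟨0, hd⟩
    · subst hj; simp [hκ]
    · simp [hκ, Pi.single_eq_of_ne hj]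
  have htsum : ∀ g : {ν : ℕ // n ≤ ν} → ℝ, (∀ ν, 0 ≤ g ν) →
      ∑' ν, ENNReal.ofReal (g ν) * ENNReal.ofReal (w ν) =
        ENNReal.ofReal (w.sum fun ν c => c * g ν) := fun g hg => by
    rw [Finsupp.sum, ENNReal.ofReal_sum_of_nonneg fun ν _ => mul_nonneg (hw.1 ν) (hg ν),
      tsum_eq_sum (s := w.support) fun ν hν => by
        rw [Finsupp.notMem_support_iff.1 hν, ENNReal.ofReal_zero, mul_zero]]
    exact Finset.sum_congr rfl fun ν _ => by rw [mul_comm, ENNReal.ofReal_mul (hw.1 ν)]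
  have hmass : ∑' ν, ENNReal.ofReal (w ν) = 1 := by
    have := htsum (fun _ => 1) fun _ => zero_le_one
    simpa [hw.2] using this
  have hpush : ∀ F : (Fin d → ℤ) → ℝ≥0∞, (∀ k, k ∉ range κ → F k = 0) →
      ∑' k, F k = ∑' ν, F (κ ν) := fun F hF =>
    (hκinj.tsum_eq fun k hk => by
      by_contra hr
      exact hk (hF k hr)).symm
  have hzero : ENNReal.ofReal (‖(0 : ℂ)‖ ^ p) = 0 := by simp [Real.zero_rpow hp.ne']
  have hsp : spNorm p f ^ p = 1 := by
    rw [spNorm_rpow hp, hpush _ fun k hk => by rw [hfc, ha0 k hk, hzero], ← hmass]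
    exact tsum_congr fun ν => by rw [hfc, hanorm]
  have hE : bestApprox p n f = 1 := by
    have h1 : bestApprox p n f ^ p = 1 := by
      rw [bestApprox_rpow hp hn hfi, hpush _ fun k hk => by
        rw [hfc, ha0 k hk, hzero, ite_self], ← hmass]
      exact tsum_congr fun ν => by rw [hl1, if_pos ν.2, hfc, hanorm]
    rw [← ENNReal.rpow_rpow_inv hp.ne' (bestApprox p n f), h1, ENNReal.one_rpow]
  have hω : modulus p α f (τ / n) ≤ ENNReal.ofReal b ^ (1 / p) := by
    refine iSup₂_le fun h hh => ?_
    have hh' : |h| ≤ τ / n := hh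
    rw [one_div, ENNReal.le_rpow_inv_iff hp, spNorm_fracDiff_rpow hp hα h hfi hY,
      hpush _ fun k hk => by rw [hfc, ha0 k hk, hzero, mul_zero]]
    rw [tsum_congr fun ν => by rw [hl1, hfc, hanorm],
      htsum (fun ν => (2 * (1 - Real.cos ((ν : ℕ) * h))) ^ (α * p / 2))
        fun ν => Real.rpow_nonneg (two_mul_one_sub_cos_nonneg _) _]
    -- Evenness of the cosine lets `t = n|h| ∈ [0, τ]` stand for a step `h` of either sign.
    refine ENNReal.ofReal_le_ofReal (le_trans (le_of_eq ?_)
      (hwb (n * |h|) ⟨by positivity, by rw [le_div_iff₀ hn0] at hh'; linarith⟩))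
    refine Finset.sum_congr rfl fun ν _ => ?_
    simp only
    rw [← mul_assoc, div_mul_cancel₀ _ hn0.ne', ← Real.cos_abs (_ * h), abs_mul, Nat.abs_cast]
  have hne : ¬ ∃ c : ℂ, f =ᵐ[volume] fun _ => c := by
    rintro ⟨c, hc⟩
    have hw0 : w ≠ 0 := by
      rintro rfl
      simpa using hw.2
    obtain ⟨ν, hν⟩ := Finsupp.ne_iff.1 hw0
    have h1 : coeff f (κ ν) = coeff (c • expo (0 : Fin d → ℤ)) (κ ν) := by
      unfold coeff
      congr 1
      refine integral_congr_ae ?_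
      filter_upwards [hc] with x hx
      rw [hx]
      simp [expo]
    have hκ0 : κ ν ≠ 0 := fun h0 => by
      have h2 := hl1 ν
      rw [h0] at h2
      have : (ν : ℕ) = 0 := by simpa [l1] using h2.symm
      have := ν.2
      omega
    rw [coeff_smul, coeff_expo, if_neg hκ0, mul_zero, hfc] at h1
    have h2 := hanorm ν
    rw [h1, norm_zero, Real.zero_rpow hp.ne'] at h2
    exact hν (by simpa using h2.symm)
  have hmem : MemSp p f := ⟨hfi, by
    rw [← ENNReal.rpow_lt_top_iff_of_pos hp, hsp]; exact ENNReal.one_lt_top⟩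
  calc (ENNReal.ofReal b)⁻¹ ^ (1 / p) = bestApprox p n f / ENNReal.ofReal b ^ (1 / p) := by
        rw [hE, ENNReal.inv_rpow, one_div]
        simp
    _ ≤ bestApprox p n f / modulus p α f (τ / n) := by gcongr
    _ ≤ constK d n α p τ :=
      le_iSup₂ (f := fun (f : Torus d → ℂ) (_ : f ∈ {f : Torus d → ℂ | MemSp p f ∧ HasSpecY f ∧
        ¬ ∃ c : ℂ, f =ᵐ[volume] fun _ => c}) => bestApprox p n f / modulus p α f (τ / n))
        f ⟨hmem, hY, hne⟩

/-- The uniform distribution on `[0, τ]` is the strategy certifying a positive value; `ν ≥ n` gives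
the frequency `ν/n ≥ 1`. -/
theorem exists_extremal_value {p α τ : ℝ} (hp : 0 < p) (hα : 0 < α) (hτ : 0 < τ) {n : ℕ}
    (hn : 1 ≤ n) :
    ∃ c > 0, (∃ m : Measure ℝ, IsProbabilityMeasure m ∧ m (Icc 0 τ)ᶜ = 0 ∧
        ∀ ν : {ν : ℕ // n ≤ ν}, c ≤
          ∫ t in Icc 0 τ, (2 * (1 - Real.cos ((ν : ℕ) / n * t))) ^ (α * p / 2) ∂m) ∧
      ∀ b > c, ∃ w ∈ weights {ν : ℕ // n ≤ ν}, ∀ t ∈ Icc 0 τ, (w.sum fun ν a =>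
        a * (2 * (1 - Real.cos ((ν : ℕ) / n * t))) ^ (α * p / 2)) ≤ b := by
  have hβ : 0 < α * p / 2 := by positivity
  have hn0 : (0 : ℝ) < n := by exact_mod_cast hn
  obtain ⟨ε, hε, hlow⟩ := exists_le_integral_one_sub_cos_rpow hτ hβ
  have hvol : volume (Icc 0 τ) = ENNReal.ofReal τ := by rw [Real.volume_Icc, sub_zero]
  have hvol0 : volume (Icc 0 τ) ≠ 0 := by rw [hvol]; simpa using hτ
  have hvolt : volume (Icc 0 τ) ≠ ∞ := by rw [hvol]; exact ENNReal.ofReal_ne_top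
  set m₀ : Measure ℝ := (volume (Icc 0 τ))⁻¹ • volume.restrict (Icc 0 τ) with hm₀
  have : IsProbabilityMeasure m₀ := ⟨by
    rw [hm₀, Measure.smul_apply, Measure.restrict_apply_univ, smul_eq_mul,
      ENNReal.inv_mul_cancel hvol0 hvolt]⟩
  have : Nonempty {ν : ℕ // n ≤ ν} := ⟨⟨n, le_rfl⟩⟩
  refine exists_minimax (m₀ := m₀) (ε := τ⁻¹ * ε)
    (fun (ν : {ν : ℕ // n ≤ ν}) t => (2 * (1 - Real.cos ((ν : ℕ) / n * t))) ^ (α * p / 2))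
    (fun ν => continuous_two_mul_one_sub_cos_rpow hβ _) ?_ (by positivity) fun ν => ?_
  · rw [hm₀, Measure.smul_apply, Measure.restrict_apply measurableSet_Icc.compl, compl_inter_self,
      measure_empty, smul_zero]
  · rw [hm₀, Measure.restrict_smul, Measure.restrict_restrict measurableSet_Icc, inter_self,
      integral_smul_measure, hvol, ENNReal.toReal_inv, ENNReal.toReal_ofReal hτ.le, smul_eq_mul,
      integral_Icc_eq_integral_Ioc, ← intervalIntegral.integral_of_le hτ.le]
    refine mul_le_mul_of_nonneg_left (hlow _ ?_) (by positivity)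
    rw [le_div_iff₀ hn0, one_mul]
    exact_mod_cast ν.2

end JacksonSp

end

theorem theorem3p1 (d : ℕ) (hd : 1 ≤ d) (p : ℝ) (hp : 1 ≤ p) (τ : ℝ) (hτ : 0 < τ)
    (n : ℕ) (hn : 1 ≤ n) (α : ℝ) (hα : 0 < α) :
    (∀ f : JacksonSp.Torus d → ℂ, JacksonSp.MemSp p f → JacksonSp.HasSpecY f →
      JacksonSp.bestApprox p n f ≤
        JacksonSp.constC n α p τ * JacksonSp.modulus p α f (τ / n)) ∧
    JacksonSp.constC n α p τ ≠ ∞ ∧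
    (∃ μ ∈ JacksonSp.admissible τ, JacksonSp.ratio n α p τ μ =
      ⨅ μ' ∈ JacksonSp.admissible τ, JacksonSp.ratio n α p τ μ') ∧
    JacksonSp.constC n α p τ = JacksonSp.constK d n α p τ := by
  have hp0 : 0 < p := one_pos.trans_le hp
  obtain ⟨c, hc, ⟨m, hm, hmIcc, hmc⟩, hw⟩ := JacksonSp.exists_extremal_value hp0 hα hτ hn
  obtain ⟨μ, hμ, hμm, hμ1⟩ := JacksonSp.exists_admissible_stieltjesMeasure_eq hτ m hmIcc
  have hlow : ∀ μ' ∈ JacksonSp.admissible τ, (ENNReal.ofReal c)⁻¹ ≤ JacksonSp.ratio n α p τ μ' :=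
    fun μ' hμ' => JacksonSp.inv_le_ratio hp0 hα hτ hc hw hμ'
  have hup : JacksonSp.ratio n α p τ μ ≤ (ENNReal.ofReal c)⁻¹ := by
    rw [JacksonSp.ratio, hμ1, ENNReal.ofReal_one, one_div]
    exact ENNReal.inv_le_inv.2 (ENNReal.ofReal_le_ofReal
      (JacksonSp.le_two_rpow_mul_infIntegral fun ν => by rw [hμm]; exact hmc ν))
  have hr : JacksonSp.ratio n α p τ μ = (ENNReal.ofReal c)⁻¹ := le_antisymm hup (hlow μ hμ)
  have hinf : ⨅ μ' ∈ JacksonSp.admissible τ, JacksonSp.ratio n α p τ μ' = (ENNReal.ofReal c)⁻¹ :=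
    le_antisymm ((iInf₂_le μ hμ).trans hup) (le_iInf₂ hlow)
  have hC : JacksonSp.constC n α p τ = (ENNReal.ofReal c)⁻¹ ^ (1 / p) := by
    rw [JacksonSp.constC, hinf]
  have hct : (ENNReal.ofReal c)⁻¹ ≠ ∞ := by simpa using hc
  have hJ : ∀ f : JacksonSp.Torus d → ℂ, JacksonSp.MemSp p f → JacksonSp.HasSpecY f →
      JacksonSp.bestApprox p n f ≤
        JacksonSp.constC n α p τ * JacksonSp.modulus p α f (τ / n) := fun f hf hY => by
    rw [hC, ← hr]
    exact JacksonSp.bestApprox_le_ratio_rpow_mul hp0 hα hτ hn hμ (by rwa [hr]) hf.1 hY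
  refine ⟨hJ, ?_, ⟨μ, hμ, hr.trans hinf.symm⟩, le_antisymm ?_ ?_⟩
  · rw [hC]
    exact ENNReal.rpow_ne_top_of_nonneg (by positivity) hct
  · rw [hC, one_div, ENNReal.rpow_inv_le_iff hp0, ENNReal.inv_le_iff_inv_le]
    -- Weights are available only for bounds above `c`, so `c + ε` is used and `ε` tends to `0`.
    refine ENNReal.le_of_forall_pos_le_add fun ε hε _ => ?_
    obtain ⟨w, hww, hwb⟩ := hw (c + ε) (by have : (0 : ℝ) < ε := hε
                                           linarith)
    have h := JacksonSp.inv_rpow_le_constK hd hp0 hα hn hww hwb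
    rw [one_div, ENNReal.rpow_inv_le_iff hp0, ENNReal.inv_le_iff_inv_le,
      ENNReal.ofReal_add hc.le ε.coe_nonneg, ENNReal.ofReal_coe_nnreal] at h
    exact h
  · exact iSup₂_le fun f hf => ENNReal.div_le_of_le_mul (hJ f hf.1 hf.2.1)
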